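/- Let $S$ be a finite set of simple steps, i.e. of vectors $(1,u)$ with $u\in\mathbb{Z}$. A walk of length $n\ge 0$ built from $S$ is a sequence $(A_0,\dots,A_n)$ of points of $\mathbb{Z}^2$ with $A_0=(0,0)$ and $A_k-A_{k-1}\in S$ for $1\le k\le n$; its final altitude is the second coordinate of $A_n$. A meander is a walk all of whose points have non-negative second coordinate. Let $w_{n,k}$ be the number of walks of length $n$ and final altitude $k$, let $m_n$ be the number of meanders of length $n$, and put \[ W(x,y)=\sum_{n\ge 0,\;k\in\mathbb{Z}} w_{n,k}\,x^n y^k\in\mathbb{Z}[y,y^{-1}][[x]],\qquad M(x)=\sum_{n\ge 0} m_n x^n,\qquad \Gamma(y)=\sum_{(1,u)\in S}y^u . \] Define \[ A(x)=[y^0]\,\frac{y}{1-y}\,W(x,y)\in\mathbb{Q}[[x]], \] where $y/(1-y)=\sum_{j\ge 1}y^j$ is expanded in powers of $y$, so that the product is taken in $\mathbb{Q}((y))[[x]]$ and $[y^0]$ is applied to each coefficient of $x^n$. Then $A(0)=0$, and in $\mathbb{Q}[[x]]$ \[ M(x)=\frac{\exp\left(-\int\frac{A(x)}{x}\,\mathrm{d}x\right)}{1-x\,\Gamma(1)},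 \] where $\int$ denotes the formal primitive with zero constant term. -/

import Mathlib

noncomputable section

namespace LatticeWalk

/-- A step set, given by the finite set `S` of the integers `u` such that the simple step `(1, u)`
is allowed. `walks S n` is the set of the walks `(A₀, …, Aₙ)` in `ℤ²` of length `n` built from
`S`: they start at the origin and every increment is an allowed step. -/
def walks (S : Finset ℤ) (n : ℕ) : Set (Fin (n + 1) → ℤ × ℤ) :=
  {A | A 0 = (0, 0) ∧ ∀ k : Fin n, ∃ u ∈ S, A k.succ - A k.castSucc = (1, u)}

/-- The second coordinate of the endpoint. -/
def finalAltitude {n : ℕ} (A : Fin (n + 1) → ℤ × ℤ) : ℤ := (A (Fin.last n)).2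

/-- Meanders: walks that stay in the (closed) upper half plane. -/
def meanders (S : Finset ℤ) (n : ℕ) : Set (Fin (n + 1) → ℤ × ℤ) :=
  {A | A ∈ walks S n ∧ ∀ k, 0 ≤ (A k).2}

/-- `w_{n,k}`: the number of walks of length `n` and final altitude `k`. -/
def walkCount (S : Finset ℤ) (n : ℕ) (k : ℤ) : ℕ :=
  {A | A ∈ walks S n ∧ finalAltitude A = k}.ncard

theorem walks_finite (S : Finset ℤ) (n : ℕ) : (walks S n).Finite := by
  have hfin : (↑(Fintype.piFinset (fun _ : Fin n => S)) : Set (Fin n → ℤ)).Finite :=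
    Finset.finite_toSet _
  refine Set.Finite.of_injOn (f := fun A k => (A k.succ - A k.castSucc).2) ?_ ?_ hfin
  · intro A hA
    simp only [Finset.mem_coe, Fintype.mem_piFinset]
    intro k
    obtain ⟨u, hu, h⟩ := hA.2 k
    rw [h]
    exact hu
  · intro A hA B hB hAB
    funext k
    induction k using Fin.induction with
    | zero => rw [hA.1, hB.1]
    | succ k ih =>
      obtain ⟨u, -, hu⟩ := hA.2 k
      obtain ⟨v, -, hv⟩ := hB.2 k
      have h := congrFun hAB k
      simp only [hu, hv] at h
      rw [← sub_add_cancel (A k.succ) (A k.castSucc), ← sub_add_cancel (B k.succ) (B k.castSucc),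
        hu, hv, h, ih]

theorem walkCount_support_finite (S : Finset ℤ) (n : ℕ) :
    (Function.support fun k : ℤ => (walkCount S n k : ℤ)).Finite := by
  refine ((walks_finite S n).image finalAltitude).subset ?_
  intro k hk
  have hk' : walkCount S n k ≠ 0 := by simpa using hk
  obtain ⟨A, hA⟩ := Set.nonempty_of_ncard_ne_zero hk'
  exact ⟨A, hA.1, hA.2⟩

/-- The full generating series `W(x, y) = ∑ w_{n,k} xⁿ yᵏ` in `ℤ[y, y⁻¹]⟦x⟧`. -/
def W (S : Finset ℤ) : PowerSeries (LaurentPolynomial ℤ) :=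
  PowerSeries.mk fun n =>
    AddMonoidAlgebra.ofCoeff (Finsupp.ofSupportFinite _ (walkCount_support_finite S n))

/-- The generating series of meanders, counted by length. -/
def M (S : Finset ℤ) : PowerSeries ℤ :=
  PowerSeries.mk fun n => ((meanders S n).ncard : ℤ)

/-- The characteristic polynomial `Γ(y) = ∑_{(1,u) ∈ S} yᵘ`, a Laurent polynomial. -/
def Gam (S : Finset ℤ) : LaurentPolynomial ℤ := ∑ u ∈ S, LaurentPolynomial.T u

/-- The number `Γ(1)`. -/
def GamOne (S : Finset ℤ) : ℤ := LaurentPolynomial.eval₂ (RingHom.id ℤ) 1 (Gam S)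

/-- The variable `y` of the field `ℚ((y))` of formal Laurent series. -/
def yVar : LaurentSeries ℚ := HahnSeries.single 1 1

theorem yVar_ne_zero : yVar ≠ 0 := HahnSeries.single_ne_zero one_ne_zero

/-- The inclusion `ℤ[y, y⁻¹] → ℚ((y))`, which sends `y` to `y`. -/
def toLaurentSeries : LaurentPolynomial ℤ →+* LaurentSeries ℚ :=
  LaurentPolynomial.eval₂ (Int.castRingHom (LaurentSeries ℚ)) (Units.mk0 yVar yVar_ne_zero)

/-- The series `y / (1 - y) · W(x, y)` in `ℚ((y))⟦x⟧`; the quotient `y / (1 - y)` is taken in the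
field `ℚ((y))`, that is, expanded in powers of `y`. -/
def yOverOneSubYMulW (S : Finset ℤ) : PowerSeries (LaurentSeries ℚ) :=
  PowerSeries.C (yVar / (1 - yVar)) * PowerSeries.map toLaurentSeries (W S)

/-- `A(x) = [y⁰] y / (1 - y) · W(x, y)`. -/
def A (S : Finset ℤ) : PowerSeries ℚ :=
  PowerSeries.mk fun n => (PowerSeries.coeff n (yOverOneSubYMulW S)).coeff 0

/-- `F / x` for a power series `F` with zero constant term. -/
def divX (F : PowerSeries ℚ) : PowerSeries ℚ :=
  PowerSeries.mk fun n => PowerSeries.coeff (n + 1) F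

/-- The formal primitive `∫ F dx` with zero constant term. -/
def integral (F : PowerSeries ℚ) : PowerSeries ℚ :=
  PowerSeries.X * PowerSeries.mk fun n => PowerSeries.coeff n F / ((n : ℚ) + 1)

/-- The exponential `exp(F)` of a power series `F` with zero constant term. -/
def expOf (F : PowerSeries ℚ) : PowerSeries ℚ :=
  PowerSeries.subst F (PowerSeries.exp ℚ)

end LatticeWalk

end

noncomputable section

namespace LatticeWalk

/-! ### Counting walks under a constraint on the altitudes -/

/-! Let `m` be the series of meanders by length and final altitude, `K = 1 - xΓ(y)` and `V = K m`.
Appending a step to a meander yields either a meander or a walk whose last point is below the axis,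
so `V` is 1 plus negative powers of `y`. Split `xΓ/(1 - xΓ) = N + B` into negative and nonnegative
powers of `y`. Since `xK' = K - 1` and `K⁻¹ = 1 + N + B`, `xV' + N V = K (x m' - m B)`. The left
side has only negative powers of `y` and `x m' - m B` has none, so both vanish by induction on the
power of `x` (`eq_zero_of_isNonneg_of_isNeg`, `X_mul_derivative_kernel_mul`). At `y = 1`, `N`
becomes `A` (`coeff_zero_mul_toLaurentSeries`), and `xV' = -A V` with `V(0) = 1` has the exponential
as its only solution (`kernel_mul_M`). -/

/-- Walks of length `n` all of whose altitudes satisfy `p`. -/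
def constrainedWalks (S : Finset ℤ) (p : ℤ → Prop) (n : ℕ) : Set (Fin (n + 1) → ℤ × ℤ) :=
  {A | A ∈ walks S n ∧ ∀ k, p (A k).2}

theorem constrainedWalks_finite (S : Finset ℤ) (p : ℤ → Prop) (n : ℕ) :
    (constrainedWalks S p n).Finite :=
  (walks_finite S n).subset fun _ h => h.1

/-- The generating Laurent polynomial of the constrained walks of length `n`, by final altitude. -/
def altitudePoly (S : Finset ℤ) (p : ℤ → Prop) (n : ℕ) : LaurentPolynomial ℤ :=
  ∑ A ∈ (constrainedWalks_finite S p n).toFinset, LaurentPolynomial.T (finalAltitude A)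

theorem coeff_altitudePoly (S : Finset ℤ) (p : ℤ → Prop) (n : ℕ) (k : ℤ) :
    (altitudePoly S p n).coeff k =
      ({A | A ∈ constrainedWalks S p n ∧ finalAltitude A = k}.ncard : ℤ) := by
  classical
  have h : {A | A ∈ constrainedWalks S p n ∧ finalAltitude A = k} =
      ↑((constrainedWalks_finite S p n).toFinset.filter fun A => finalAltitude A = k) := by
    ext A; simp
  rw [h, Set.ncard_coe_finset, altitudePoly, AddMonoidAlgebra.coeff_sum, Finset.sum_apply']
  simp

theorem snoc_mem_walks_iff {S : Finset ℤ} {n : ℕ} {A : Fin (n + 1) → ℤ × ℤ} {P : ℤ × ℤ} :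
    (Fin.snoc A P : Fin (n + 2) → ℤ × ℤ) ∈ walks S (n + 1) ↔
      A ∈ walks S n ∧ ∃ u ∈ S, P - A (Fin.last n) = (1, u) := by
  have h0 : (Fin.snoc A P : Fin (n + 2) → ℤ × ℤ) 0 = A 0 := by
    rw [← Fin.castSucc_zero]; exact Fin.snoc_castSucc (α := fun _ => ℤ × ℤ) _ _ _
  have hc (i : Fin (n + 1)) : (Fin.snoc A P : Fin (n + 2) → ℤ × ℤ) i.castSucc = A i :=
    Fin.snoc_castSucc (α := fun _ => ℤ × ℤ) _ _ _
  have hl : (Fin.snoc A P : Fin (n + 2) → ℤ × ℤ) (Fin.last (n + 1)) = P :=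
    Fin.snoc_last (α := fun _ => ℤ × ℤ) _ _
  simp only [walks, Set.mem_ofPred_eq, Fin.forall_fin_succ' (n := n), h0, ← Fin.castSucc_succ, hc,
    Fin.succ_last, hl, and_assoc]

theorem snoc_mem_constrainedWalks_iff {S : Finset ℤ} {p : ℤ → Prop} {n : ℕ}
    {A : Fin (n + 1) → ℤ × ℤ} {P : ℤ × ℤ} :
    (Fin.snoc A P : Fin (n + 2) → ℤ × ℤ) ∈ constrainedWalks S p (n + 1) ↔
      A ∈ constrainedWalks S p n ∧ (∃ u ∈ S, P - A (Fin.last n) = (1, u)) ∧ p P.2 := by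
  simp only [constrainedWalks, Set.mem_ofPred_eq, snoc_mem_walks_iff, Fin.forall_fin_succ' (n := n + 1),
    Fin.snoc_castSucc, Fin.snoc_last]
  tauto

/-- Removal of the last step. Only the endpoint brings a new constraint, and `hk` grants it. -/
theorem ncard_constrainedWalks_succ (S : Finset ℤ) (p : ℤ → Prop) (n : ℕ) {k : ℤ} (hk : p k) :
    {A | A ∈ constrainedWalks S p (n + 1) ∧ finalAltitude A = k}.ncard =
      ∑ u ∈ S, {A | A ∈ constrainedWalks S p n ∧ finalAltitude A = k - u}.ncard := by
  classical
  let extend (u : ℤ) (A : Fin (n + 1) → ℤ × ℤ) : Fin (n + 2) → ℤ × ℤ :=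
    Fin.snoc A (A (Fin.last n) + (1, u))
  have hinj (u : ℤ) : Function.Injective (extend u) := by
    intro A B h
    have := congrArg (Fin.init (α := fun _ => ℤ × ℤ)) h
    simpa [extend, Fin.init_snoc] using this
  have hfin (m : ℕ) (l : ℤ) :
      {A | A ∈ constrainedWalks S p m ∧ finalAltitude A = l}.Finite :=
    (constrainedWalks_finite S p m).subset fun _ h => h.1
  have hset : {A | A ∈ constrainedWalks S p (n + 1) ∧ finalAltitude A = k} =
      ↑(S.biUnion fun u => (hfin n (k - u)).toFinset.image (extend u)) := by
    ext B
    induction B using Fin.snocCases with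
    | snoc A P =>
    simp only [Set.mem_ofPred_eq, snoc_mem_constrainedWalks_iff, finalAltitude, Fin.snoc_last,
      Finset.coe_biUnion, Finset.mem_coe, Finset.coe_image, Set.Finite.coe_toFinset,
      Set.mem_iUnion, Set.mem_image, exists_prop]
    constructor
    · rintro ⟨⟨hA, ⟨u, hu, h⟩, -⟩, rfl⟩
      have hP : P = A (Fin.last n) + (1, u) := by rw [← h]; abel
      refine ⟨u, hu, A, ⟨hA, ?_⟩, by rw [hP]⟩
      rw [hP]; simp
    · rintro ⟨u, hu, A', ⟨hA', hl⟩, h⟩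
      obtain ⟨rfl, rfl⟩ := Fin.snoc_injective2 (α := fun _ => ℤ × ℤ) h
      have : (A' (Fin.last n) + ((1, u) : ℤ × ℤ)).2 = k := by simp [hl]
      exact ⟨⟨hA', ⟨u, hu, by simp⟩, by rw [this]; exact hk⟩, this⟩
  rw [hset, Set.ncard_coe_finset, Finset.card_biUnion]
  · refine Finset.sum_congr rfl fun u _ => ?_
    rw [Finset.card_image_of_injective _ (hinj u), Set.ncard_eq_toFinset_card _ (hfin n (k - u))]
  · intro u _ v _ huv
    rw [Function.onFun, Finset.disjoint_left]
    intro B hB hB'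
    simp only [Finset.mem_image, Set.Finite.mem_toFinset, Set.mem_ofPred_eq] at hB hB'
    obtain ⟨A, ⟨-, hA⟩, rfl⟩ := hB
    obtain ⟨A', ⟨-, hA'⟩, h⟩ := hB'
    obtain ⟨rfl, -⟩ := Fin.snoc_injective2 (α := fun _ => ℤ × ℤ) h
    exact huv (by linarith)

theorem coeff_Gam_mul (S : Finset ℤ) (f : LaurentPolynomial ℤ) (k : ℤ) :
    (Gam S * f).coeff k = ∑ u ∈ S, f.coeff (k - u) := by
  rw [Gam, Finset.sum_mul, AddMonoidAlgebra.coeff_sum, Finset.sum_apply']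
  refine Finset.sum_congr rfl fun u _ => ?_
  rw [LaurentPolynomial.T, AddMonoidAlgebra.coeff_single_mul_apply, one_mul, neg_add_eq_sub]

theorem coeff_altitudePoly_succ (S : Finset ℤ) (p : ℤ → Prop) (n : ℕ) {k : ℤ} (hk : p k) :
    (altitudePoly S p (n + 1)).coeff k = (Gam S * altitudePoly S p n).coeff k := by
  rw [coeff_Gam_mul, coeff_altitudePoly, ncard_constrainedWalks_succ S p n hk]
  push_cast
  exact Finset.sum_congr rfl fun u _ => (coeff_altitudePoly S p n _).symm

theorem altitudePoly_zero (S : Finset ℤ) (p : ℤ → Prop) (h0 : p 0) : altitudePoly S p 0 = 1 := by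
  have : (constrainedWalks_finite S p 0).toFinset = {fun _ => (0, 0)} := by
    ext A
    simp only [Set.Finite.mem_toFinset, constrainedWalks, walks, Set.mem_ofPred_eq,
      Finset.mem_singleton, IsEmpty.forall_iff, and_true]
    constructor
    · rintro ⟨h, -⟩
      funext i
      rw [Fin.fin_one_eq_zero i, h]
    · rintro rfl
      exact ⟨rfl, fun _ => h0⟩
  rw [altitudePoly, this]
  simp [finalAltitude]

theorem altitudePoly_true (S : Finset ℤ) (n : ℕ) :
    altitudePoly S (fun _ => True) n = Gam S ^ n := by
  induction n with
  | zero => rw [altitudePoly_zero S _ trivial, pow_zero]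
  | succ n ih =>
    rw [pow_succ', ← ih]
    ext k
    exact coeff_altitudePoly_succ S _ n trivial

theorem coeff_W (S : Finset ℤ) (n : ℕ) : PowerSeries.coeff n (W S) = Gam S ^ n := by
  rw [← altitudePoly_true]
  ext k
  rw [coeff_altitudePoly, W, PowerSeries.coeff_mk]
  simp [Finsupp.ofSupportFinite_coe, walkCount, constrainedWalks]

/-- Evaluation of a Laurent polynomial at `y = 1`. -/
def evalOne : LaurentPolynomial ℤ →+* ℤ := LaurentPolynomial.eval₂ (RingHom.id ℤ) 1

theorem evalOne_T (k : ℤ) : evalOne (LaurentPolynomial.T k) = 1 := by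
  simp [evalOne]

theorem evalOne_altitudePoly (S : Finset ℤ) (n : ℕ) :
    evalOne (altitudePoly S (0 ≤ ·) n) = (meanders S n).ncard := by
  rw [altitudePoly, map_sum]
  simp only [evalOne_T, Finset.sum_const, nsmul_eq_mul, mul_one]
  rw [← Set.ncard_eq_toFinset_card _ (constrainedWalks_finite S _ n)]
  rfl

/-! ### Laurent polynomials supported on one side -/

/-- Laurent polynomials without negative powers. -/
def IsNonneg (f : LaurentPolynomial ℤ) : Prop := ∀ k < 0, f.coeff k = 0

/-- Laurent polynomials with negative powers only. -/
def IsNeg (f : LaurentPolynomial ℤ) : Prop := ∀ k, 0 ≤ k → f.coeff k = 0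

theorem coeff_mul_eq_zero {f g : LaurentPolynomial ℤ} {k : ℤ}
    (h : ∀ i j, i + j = k → f.coeff i = 0 ∨ g.coeff j = 0) : (f * g).coeff k = 0 := by
  rw [AddMonoidAlgebra.coeff_mul]
  refine Finset.sum_eq_zero fun i _ => Finset.sum_eq_zero fun j _ => ?_
  dsimp only
  split_ifs with hij
  · rcases h i j hij with h | h <;> simp [h]
  · rfl

theorem IsNonneg.mul {f g : LaurentPolynomial ℤ} (hf : IsNonneg f) (hg : IsNonneg g) :
    IsNonneg (f * g) := fun k hk => coeff_mul_eq_zero fun i j hij => by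
  rcases lt_or_ge i 0 with hi | hi
  · exact Or.inl (hf i hi)
  · exact Or.inr (hg j (by lia))

theorem IsNeg.mul {f g : LaurentPolynomial ℤ} (hf : IsNeg f) (hg : IsNeg g) :
    IsNeg (f * g) := fun k hk => coeff_mul_eq_zero fun i j hij => by
  rcases lt_or_ge i 0 with hi | hi
  · exact Or.inr (hg j (by lia))
  · exact Or.inl (hf i hi)

theorem IsNonneg.eq_zero {f : LaurentPolynomial ℤ} (hf : IsNonneg f) (hf' : IsNeg f) : f = 0 := by
  ext k
  rcases lt_or_ge k 0 with hk | hk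
  · simpa using hf k hk
  · simpa using hf' k hk

theorem IsNeg.add {f g : LaurentPolynomial ℤ} (hf : IsNeg f) (hg : IsNeg g) :
    IsNeg (f + g) := fun k hk => by simp [hf k hk, hg k hk]

theorem IsNonneg.sum {ι : Type*} {s : Finset ι} {f : ι → LaurentPolynomial ℤ}
    (hf : ∀ i ∈ s, IsNonneg (f i)) : IsNonneg (∑ i ∈ s, f i) := fun k hk => by
  rw [AddMonoidAlgebra.coeff_sum, Finset.sum_apply']
  exact Finset.sum_eq_zero fun i hi => hf i hi k hk

theorem IsNeg.sum {ι : Type*} {s : Finset ι} {f : ι → LaurentPolynomial ℤ}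
    (hf : ∀ i ∈ s, IsNeg (f i)) : IsNeg (∑ i ∈ s, f i) := fun k hk => by
  rw [AddMonoidAlgebra.coeff_sum, Finset.sum_apply']
  exact Finset.sum_eq_zero fun i hi => hf i hi k hk

/-- The part of a Laurent polynomial formed by the negative powers. -/
def negPart (f : LaurentPolynomial ℤ) : LaurentPolynomial ℤ :=
  AddMonoidAlgebra.ofCoeff (f.coeff.filter (· < 0))

theorem coeff_negPart (f : LaurentPolynomial ℤ) (k : ℤ) :
    (negPart f).coeff k = if k < 0 then f.coeff k else 0 := by
  simp [negPart, Finsupp.filter_apply]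

theorem isNeg_negPart (f : LaurentPolynomial ℤ) : IsNeg (negPart f) := fun k hk => by
  rw [coeff_negPart, if_neg hk.not_gt]

theorem isNonneg_sub_negPart (f : LaurentPolynomial ℤ) : IsNonneg (f - negPart f) := fun k hk => by
  simp [coeff_negPart, hk]

theorem negPart_one : negPart 1 = 0 := by
  ext k
  rw [coeff_negPart, ← LaurentPolynomial.T_zero, LaurentPolynomial.T_apply]
  split_ifs
  · lia
  · rfl
  · rfl

theorem negPart_add (f g : LaurentPolynomial ℤ) : negPart (f + g) = negPart f + negPart g := by
  ext k
  simp only [AddMonoidAlgebra.coeff_add, Finsupp.add_apply, coeff_negPart]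
  split_ifs <;> simp

/-- As `y/(1 - y) = ∑_{j ≥ 1} y^j`, taking `[y⁰]` adds up the coefficients of all `y^(-j)` with `j ≥
1`. By linearity, monomials suffice. -/
theorem coeff_zero_mul_toLaurentSeries (f : LaurentPolynomial ℤ) :
    (yVar / (1 - yVar) * toLaurentSeries f).coeff 0 = (evalOne (negPart f) : ℚ) := by
  have hgeom : yVar / (1 - yVar) = yVar * HahnSeries.ofPowerSeries ℤ ℚ (PowerSeries.mk 1) := by
    have h : HahnSeries.ofPowerSeries ℤ ℚ (PowerSeries.mk 1) * (1 - yVar) = 1 := by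
      have := congrArg (HahnSeries.ofPowerSeries ℤ ℚ) (PowerSeries.mk_one_mul_one_sub_eq_one ℚ)
      simpa [yVar, HahnSeries.ofPowerSeries_X] using this
    have h0 : (1 - yVar) ≠ 0 := right_ne_zero_of_mul_eq_one h
    rw [div_eq_iff h0, mul_assoc, h, mul_one]
  induction f using LaurentPolynomial.induction_on' with
  | add f g hf hg => simp [mul_add, negPart_add, hf, hg]
  | C_mul_T k a =>
    have hneg : negPart (LaurentPolynomial.C a * LaurentPolynomial.T k) =
        if k < 0 then LaurentPolynomial.C a * LaurentPolynomial.T k else 0 := by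
      rw [← LaurentPolynomial.single_eq_C_mul_T]
      ext j
      rw [coeff_negPart]
      by_cases hjk : k = j
      · subst hjk; split_ifs <;> rfl
      · have : (AddMonoidAlgebra.single k a : LaurentPolynomial ℤ).coeff j = 0 := by
          rw [AddMonoidAlgebra.coeff_single, Finsupp.single_eq_of_ne (Ne.symm hjk)]
        split_ifs <;> simp only [this, AddMonoidAlgebra.coeff_zero, Finsupp.zero_apply]
    have hL : toLaurentSeries (LaurentPolynomial.C a * LaurentPolynomial.T k) =
        HahnSeries.single k (a : ℚ) := by
      have hC : (a : LaurentSeries ℚ) = HahnSeries.single 0 (a : ℚ) := by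
        rw [← HahnSeries.C_apply, map_intCast]
      rw [toLaurentSeries, LaurentPolynomial.eval₂_C_mul_T, Units.val_zpow_eq_zpow_val]
      simp only [Units.val_mk0, yVar, eq_intCast]
      rw [← RatFunc.single_zpow, hC, HahnSeries.single_mul_single, zero_add, mul_one]
    have hprod : yVar / (1 - yVar) * HahnSeries.single k (a : ℚ) =
        HahnSeries.ofPowerSeries ℤ ℚ (PowerSeries.mk 1) * HahnSeries.single (k + 1) (a : ℚ) := by
      rw [hgeom, mul_comm yVar, mul_assoc, yVar, HahnSeries.single_mul_single, one_mul, add_comm]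
    -- Writing 0 as `-(k + 1) + (k + 1)` exposes the coefficient of the geometric series at `-(k +
    -- 1)`, which is 1 exactly when `k < 0`.
    rw [hL, hprod, hneg, ← neg_add_cancel (k + 1), HahnSeries.coeff_mul_single_add,
      PowerSeries.coeff_coe]
    rcases lt_or_ge k 0 with hk | hk
    · rw [if_neg (by lia), if_pos (by lia), map_mul, evalOne_T]
      simp [evalOne]
    · rw [if_pos (by lia), if_neg (by lia)]
      simp

theorem coeff_A (S : Finset ℤ) (n : ℕ) :
    PowerSeries.coeff n (A S) = (evalOne (negPart (Gam S ^ n)) : ℚ) := by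
  rw [A, PowerSeries.coeff_mk, yOverOneSubYMulW, PowerSeries.coeff_C_mul, PowerSeries.coeff_map,
    coeff_W, coeff_zero_mul_toLaurentSeries]

theorem constantCoeff_A (S : Finset ℤ) : PowerSeries.constantCoeff (A S) = 0 := by
  rw [← PowerSeries.coeff_zero_eq_constantCoeff_apply, coeff_A, pow_zero, negPart_one,
    map_zero, Int.cast_zero]

/-! ### The factorization of the kernel `1 - x Γ(y)` -/

open PowerSeries in
/-- If `Z` has no negative powers of `y`, and `(1 - x g) Z` only has negative ones, then `Z = 0`. -/
theorem eq_zero_of_isNonneg_of_isNeg {g : LaurentPolynomial ℤ}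
    {Z : PowerSeries (LaurentPolynomial ℤ)} (hZ : ∀ n, IsNonneg (coeff n Z))
    (hneg : ∀ n, IsNeg (coeff n ((1 - X * C g) * Z))) : Z = 0 := by
  ext1 n
  induction n with
  | zero =>
    have h := hneg 0
    simp only [sub_mul, one_mul, mul_assoc, map_sub, coeff_zero_X_mul, sub_zero] at h
    exact (hZ 0).eq_zero h
  | succ n ih =>
    have h := hneg (n + 1)
    -- The term in `g` involves only the previous coefficient of `Z`, already known to vanish.
    rw [sub_mul, one_mul, mul_assoc, map_sub, coeff_succ_X_mul, coeff_C_mul, ih, map_zero, mul_zero,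
      sub_zero] at h
    exact (hZ (n + 1)).eq_zero h

/-- The generating series of meanders, by length and final altitude. -/
def meanderSeries (S : Finset ℤ) : PowerSeries (LaurentPolynomial ℤ) :=
  PowerSeries.mk (altitudePoly S (0 ≤ ·))

/-- The part of `x Γ / (1 - x Γ)` formed by the negative powers of `y`. -/
def negSeries (S : Finset ℤ) : PowerSeries (LaurentPolynomial ℤ) :=
  PowerSeries.mk fun n => negPart (Gam S ^ n)

theorem isNonneg_altitudePoly (S : Finset ℤ) (n : ℕ) : IsNonneg (altitudePoly S (0 ≤ ·) n) := by
  intro k hk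
  rw [coeff_altitudePoly, Nat.cast_eq_zero]
  suffices h : {A | A ∈ constrainedWalks S (0 ≤ ·) n ∧ finalAltitude A = k} = ∅ by
    rw [h, Set.ncard_empty]
  rw [Set.eq_empty_iff_forall_notMem]
  rintro A ⟨⟨-, hA⟩, h⟩
  exact hk.not_ge (h ▸ hA (Fin.last n))

open PowerSeries in
-- At altitudes `k ≥ 0` the last-step recursion makes the two terms cancel. Length 0 is excluded:
-- there the coefficient is 1.
theorem isNeg_coeff_kernel_mul (S : Finset ℤ) {n : ℕ} (hn : n ≠ 0) :
    IsNeg (coeff n ((1 - X * C (Gam S)) * meanderSeries S)) := by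
  obtain ⟨n, rfl⟩ := Nat.exists_eq_succ_of_ne_zero hn
  intro k hk
  rw [sub_mul, one_mul, mul_assoc, map_sub, coeff_succ_X_mul, coeff_C_mul, meanderSeries, coeff_mk,
    coeff_mk, AddMonoidAlgebra.coeff_sub, Finsupp.sub_apply, coeff_altitudePoly_succ S _ n hk,
    sub_self]

theorem IsNonneg.natCast_mul {f : LaurentPolynomial ℤ} (hf : IsNonneg f) (n : ℕ) :
    IsNonneg (f * n) := by
  intro k hk
  rw [mul_comm, ← nsmul_eq_mul, AddMonoidAlgebra.coeff_smul_apply, hf k hk, smul_zero]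

theorem IsNeg.natCast_mul {f : LaurentPolynomial ℤ} (hf : IsNeg f) (n : ℕ) :
    IsNeg (f * n) := by
  intro k hk
  rw [mul_comm, ← nsmul_eq_mul, AddMonoidAlgebra.coeff_smul_apply, hf k hk, smul_zero]

theorem coeff_X_mul_derivative {R : Type*} [CommSemiring R] (F : PowerSeries R) (n : ℕ) :
    PowerSeries.coeff n (PowerSeries.X * PowerSeries.derivative R F) =
      PowerSeries.coeff n F * n := by
  cases n with
  | zero => simp
  | succ n => rw [PowerSeries.coeff_succ_X_mul, PowerSeries.coeff_derivative]; push_cast; rfl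

open PowerSeries in
/-- The series `V = (1 - x Γ) M` satisfies `x V' = - N V`, where `N` is the part of
`x Γ / (1 - x Γ)` formed by the negative powers of `y`. -/
theorem X_mul_derivative_kernel_mul (S : Finset ℤ) :
    X * derivative _ ((1 - X * C (Gam S)) * meanderSeries S) +
      negSeries S * ((1 - X * C (Gam S)) * meanderSeries S) = 0 := by
  set R := LaurentPolynomial ℤ
  set K : PowerSeries R := 1 - X * C (Gam S) with hK
  set m := meanderSeries S with hm
  set N := negSeries S with hN
  set G : PowerSeries R := mk fun n => Gam S ^ n with hG
  set B : PowerSeries R := G - 1 - N with hB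
  have hN0 : coeff 0 N = 0 := by rw [hN, negSeries, coeff_mk, pow_zero, negPart_one]
  have hGK : K * G = 1 := by
    ext1 n
    rw [hK, sub_mul, one_mul, mul_assoc, map_sub]
    cases n with
    | zero => simp [hG]
    | succ n => simp [hG, coeff_succ_X_mul, coeff_one, pow_succ']
  have hdK : X * derivative R K = K - 1 := by
    rw [hK]
    simp only [map_sub, derivative_one, Derivation.leibniz, derivative_C, derivative_X, smul_eq_mul]
    ring
  have hBnn (n : ℕ) : IsNonneg (coeff n B) := by
    rw [hB, map_sub, map_sub]
    cases n with
    | zero => simp [hN0, hG, IsNonneg]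
    | succ n =>
      rw [hG, coeff_mk, coeff_one, if_neg n.succ_ne_zero, sub_zero, hN, negSeries, coeff_mk]
      exact isNonneg_sub_negPart _
  -- From `K G = 1`, `K - 1 = K (1 - G)`, and `1 - G + N = -B`.
  have key : X * derivative R (K * m) + N * (K * m) = K * (X * derivative R m - m * B) := by
    have h1 : X * derivative R (K * m) = (K - 1) * m + K * (X * derivative R m) := by
      rw [Derivation.leibniz, smul_eq_mul, smul_eq_mul, ← hdK]; ring
    rw [h1, hB]
    linear_combination m * hGK
  rw [key]
  have hZ : X * derivative R m - m * B = 0 := by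
    refine eq_zero_of_isNonneg_of_isNeg (g := Gam S) (fun n => ?_) (fun n => ?_)
    · have h1 : IsNonneg (coeff n (X * derivative R m)) := by
        rw [coeff_X_mul_derivative, hm, meanderSeries, coeff_mk]
        exact (isNonneg_altitudePoly S n).natCast_mul n
      have h2 : IsNonneg (coeff n (m * B)) := by
        rw [coeff_mul]
        refine IsNonneg.sum fun i _ => IsNonneg.mul ?_ (hBnn _)
        rw [hm, meanderSeries, coeff_mk]
        exact isNonneg_altitudePoly S _
      intro k hk
      rw [map_sub, AddMonoidAlgebra.coeff_sub, Finsupp.sub_apply, h1 k hk, h2 k hk, sub_zero]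
    · rw [← hK, ← key, map_add]
      have hV0 : coeff 0 (K * m) = 1 := by
        rw [hK, sub_mul, one_mul, mul_assoc, map_sub, coeff_zero_X_mul, sub_zero, hm, meanderSeries,
          coeff_mk, altitudePoly_zero S _ le_rfl]
      have hNn (n : ℕ) : IsNeg (coeff n N) := by
        rw [hN, negSeries, coeff_mk]; exact isNeg_negPart _
      refine IsNeg.add ?_ ?_
      · rw [coeff_X_mul_derivative]
        -- The factor `n` kills the constant term 1, the only part of `K * m` that is not negative
        -- in `y`.
        rcases eq_or_ne n 0 with rfl | hn
        · intro k _; simp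
        · exact (isNeg_coeff_kernel_mul S hn).natCast_mul n
      · rw [coeff_mul]
        refine IsNeg.sum fun i _ => ?_
        -- The constant term 1 of `K * m` leaves a coefficient of `N`; every other term is a product
        -- of two negative parts.
        rcases eq_or_ne i.2 0 with h | h
        · rw [h, hV0, mul_one]; exact hNn _
        · exact (hNn _).mul (isNeg_coeff_kernel_mul S h)
  rw [hZ, mul_zero]

/-! ### The differential equation -/

open PowerSeries in
-- The quotient `F / G` has zero derivative and constant term 1.
theorem eq_of_derivative_eq_mul {F G P : PowerSeries ℚ}
    (hF : derivative ℚ F = P * F) (hG : derivative ℚ G = P * G)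
    (h : constantCoeff F = constantCoeff G) (hG0 : constantCoeff G ≠ 0) : F = G := by
  have h1 : F * G⁻¹ = 1 := by
    refine derivative.ext ?_ ?_
    · rw [Derivation.leibniz, derivative_inv', hF, hG, derivative_one, smul_eq_mul, smul_eq_mul]
      linear_combination (-F * P * G⁻¹) * (PowerSeries.mul_inv_cancel G hG0)
    · rw [map_mul, constantCoeff_inv, h, mul_inv_cancel₀ hG0, map_one]
  rw [← mul_one F, ← PowerSeries.inv_mul_cancel G hG0, ← mul_assoc, h1, one_mul]

theorem X_mul_divX {F : PowerSeries ℚ} (h : PowerSeries.constantCoeff F = 0) :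
    PowerSeries.X * divX F = F := by
  ext n
  cases n with
  | zero => simp [h]
  | succ n => rw [PowerSeries.coeff_succ_X_mul, divX, PowerSeries.coeff_mk]

theorem derivative_integral (F : PowerSeries ℚ) :
    PowerSeries.derivative ℚ (integral F) = F := by
  ext n
  rw [PowerSeries.coeff_derivative, integral, PowerSeries.coeff_succ_X_mul, PowerSeries.coeff_mk]
  field_simp

theorem constantCoeff_integral (F : PowerSeries ℚ) :
    PowerSeries.constantCoeff (integral F) = 0 := by
  simp [integral]

theorem derivative_expOf {F : PowerSeries ℚ} (h : PowerSeries.constantCoeff F = 0) :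
    PowerSeries.derivative ℚ (expOf F) = PowerSeries.derivative ℚ F * expOf F := by
  rw [expOf, PowerSeries.derivative_subst (PowerSeries.HasSubst.of_constantCoeff_zero' h),
    PowerSeries.derivative_exp, mul_comm]

theorem constantCoeff_expOf {F : PowerSeries ℚ} (h : PowerSeries.constantCoeff F = 0) :
    PowerSeries.constantCoeff (expOf F) = 1 := by
  -- `constantCoeff_subst_eq_zero` is applied to an outer series without constant term, hence `exp -
  -- 1`.
  have h1 : expOf F - 1 = PowerSeries.subst F (PowerSeries.exp ℚ - 1) := by
    have hs := PowerSeries.HasSubst.of_constantCoeff_zero' h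
    rw [expOf, ← PowerSeries.coe_substAlgHom hs, map_sub, map_one]
  have h2 : PowerSeries.constantCoeff (expOf F - 1) = 0 := by
    rw [h1]
    exact PowerSeries.constantCoeff_subst_eq_zero h _ (by simp)
  rw [map_sub, map_one] at h2
  linarith

/-! ### Specialization at `y = 1` -/

/-- Evaluation at `y = 1` with values in `ℚ`, coefficientwise. -/
def evalOneSeries : PowerSeries (LaurentPolynomial ℤ) →+* PowerSeries ℚ :=
  PowerSeries.map ((Int.castRingHom ℚ).comp evalOne)

theorem coeff_evalOneSeries (F : PowerSeries (LaurentPolynomial ℤ)) (n : ℕ) :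
    PowerSeries.coeff n (evalOneSeries F) = (evalOne (PowerSeries.coeff n F) : ℚ) := by
  simp [evalOneSeries]

theorem evalOneSeries_meanderSeries (S : Finset ℤ) :
    evalOneSeries (meanderSeries S) = PowerSeries.map (Int.castRingHom ℚ) (M S) := by
  ext n
  rw [coeff_evalOneSeries, meanderSeries, PowerSeries.coeff_mk, evalOne_altitudePoly,
    PowerSeries.coeff_map, M, PowerSeries.coeff_mk]
  simp

theorem evalOneSeries_negSeries (S : Finset ℤ) : evalOneSeries (negSeries S) = A S := by
  ext n
  rw [coeff_evalOneSeries, negSeries, PowerSeries.coeff_mk, coeff_A]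

theorem evalOneSeries_kernel (S : Finset ℤ) :
    evalOneSeries (1 - PowerSeries.X * PowerSeries.C (Gam S)) =
      1 - PowerSeries.X * PowerSeries.C (GamOne S : ℚ) := by
  simp [evalOneSeries, evalOne, GamOne]

theorem evalOneSeries_X_mul_derivative (F : PowerSeries (LaurentPolynomial ℤ)) :
    evalOneSeries (PowerSeries.X * PowerSeries.derivative _ F) =
      PowerSeries.X * PowerSeries.derivative ℚ (evalOneSeries F) := by
  ext n
  rw [coeff_evalOneSeries, coeff_X_mul_derivative, coeff_X_mul_derivative, coeff_evalOneSeries]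
  simp

theorem kernel_mul_M (S : Finset ℤ) :
    (1 - PowerSeries.X * PowerSeries.C (GamOne S : ℚ)) *
        PowerSeries.map (Int.castRingHom ℚ) (M S) = expOf (-integral (divX (A S))) := by
  have h0 : PowerSeries.constantCoeff (-integral (divX (A S))) = 0 := by
    rw [map_neg, constantCoeff_integral, neg_zero]
  refine eq_of_derivative_eq_mul (P := -divX (A S)) ?_ ?_ ?_ ?_
  · have h := congrArg evalOneSeries (X_mul_derivative_kernel_mul S)
    rw [map_add, evalOneSeries_X_mul_derivative, map_mul evalOneSeries (negSeries S),
      map_mul evalOneSeries (1 - _), evalOneSeries_kernel, evalOneSeries_meanderSeries,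
      evalOneSeries_negSeries, map_zero] at h
    -- The specialized equation governs `x V'`; cancelling `x` turns `A` into `A / x`, which uses
    -- `A(0) = 0`.
    refine mul_left_cancel₀ (PowerSeries.X_ne_zero (R := ℚ)) ?_
    rw [← mul_assoc, mul_neg, X_mul_divX (constantCoeff_A S)]
    linear_combination h
  · rw [derivative_expOf h0, map_neg, derivative_integral]
  · have hM : PowerSeries.constantCoeff (PowerSeries.map (Int.castRingHom ℚ) (M S)) = 1 := by
      rw [← evalOneSeries_meanderSeries, ← PowerSeries.coeff_zero_eq_constantCoeff_apply,
        coeff_evalOneSeries, meanderSeries, PowerSeries.coeff_mk,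
        altitudePoly_zero S _ le_rfl, map_one, Int.cast_one]
    rw [constantCoeff_expOf h0, map_mul, hM]
    simp
  · rw [constantCoeff_expOf h0]; exact one_ne_zero

end LatticeWalk

end

theorem mainTheorem6 (S : Finset ℤ) :
    PowerSeries.constantCoeff (LatticeWalk.A S) = 0 ∧
      PowerSeries.map (Int.castRingHom ℚ) (LatticeWalk.M S) =
        LatticeWalk.expOf (-LatticeWalk.integral (LatticeWalk.divX (LatticeWalk.A S))) *
          (1 - PowerSeries.X * PowerSeries.C (LatticeWalk.GamOne S : ℚ))⁻¹ := by
  refine ⟨LatticeWalk.constantCoeff_A S, ?_⟩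
  rw [PowerSeries.eq_mul_inv_iff_mul_eq (by simp), mul_comm, LatticeWalk.kernel_mul_M]
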